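/- Let $x=(x_1,\dots,x_d)$ be a real random vector whose moment generating function $M_x(t)=\mathbb{E}[e^{t^{T}x}]$ is finite for all $t$ in a neighbourhood of $0\in\mathbb{R}^d$. Let $K_x(t)=\log M_x(t)$ be its cumulant generating function and, for $r\ge 1$ and $i_1,\dots,i_r\in\{1,\dots,d\}$ (repetitions allowed), let $$\kappa_r(x)_{i_1\cdots i_r}=\frac{\partial^r K_x}{\partial t_{i_1}\cdots\partial t_{i_r}}(0)$$ be the entries of its $r$-th cumulant tensor. For $I\subseteq\{1,\dots,d\}$ write $x_I=(x_i)_{i\in I}$. (1) Let $I,J\subseteq\{1,\dots,d\}$ be disjoint. The random vectors $x_I$ and $x_J$ are independent if and only if $\kappa_r(x)_{i_1\cdots i_r}=0$ for every $r$ and all indices $i_1,\dots,i_r\in I\cup J$ of which at least one lies in $I$ and at least one lies in $J$. (2) Let $I_1,\dots,I_m$ be pairwise disjoint sets with union $\{1,\dots,d\}$. The random vectors $x_{I_1},\dots,x_{I_m}$ are mutually independent if and only if $\kappa_r(x)_{i_1\cdots i_r}=0$ for every $r$ and all indices $i_1,\dots,i_r$ that do not all lie in the same block, i.e. such that for some $j\neq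 k$ at least one of them lies in $I_j$ and at least one in $I_k$. (3) The components $x_1,\dots,x_d$ are mutually independent if and only if for every $r\ge 2$ the tensor $\kappa_r(x)$ is diagonal, i.e. $\kappa_r(x)_{i_1\cdots i_r}=0$ unless $i_1=\dots=i_r$. -/

import Mathlib

open MeasureTheory ProbabilityTheory Filter Topology

noncomputable section

/-- The moment generating function `M_x(t) = 𝔼[exp (tᵀ x)]` of the random vector
`x = (x_1, …, x_d)`. -/
def vecMGF {Ω : Type*} [MeasurableSpace Ω] {d : ℕ} (x : Fin d → Ω → ℝ) (μ : Measure Ω)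
    (t : Fin d → ℝ) : ℝ :=
  ∫ ω, Real.exp (∑ i, t i * x i ω) ∂μ

/-- The cumulant generating function `K_x(t) = log M_x(t)`. -/
def vecCGF {Ω : Type*} [MeasurableSpace Ω] {d : ℕ} (x : Fin d → Ω → ℝ) (μ : Measure Ω)
    (t : Fin d → ℝ) : ℝ :=
  Real.log (vecMGF x μ t)

/-- The `r`-th cumulant tensor: its entry at `(i_1, …, i_r)` is the mixed partial derivative
`∂^r K_x / ∂t_{i_1} ⋯ ∂t_{i_r}` at `t = 0`, i.e. the `r`-th derivative of `K_x` at `0` evaluated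
at the standard basis vectors `e_{i_1}, …, e_{i_r}`. -/
def cumulantTensor {Ω : Type*} [MeasurableSpace Ω] {d : ℕ} (x : Fin d → Ω → ℝ) (μ : Measure Ω)
    (r : ℕ) (i : Fin r → Fin d) : ℝ :=
  iteratedFDeriv ℝ r (vecCGF x μ) 0 (fun k => Pi.single (i k) (1 : ℝ))

/-- The random subvector `x_I = (x_i)_{i ∈ I}`. -/
def subvector {Ω : Type*} {d : ℕ} (x : Fin d → Ω → ℝ) (I : Finset (Fin d)) :
    Ω → (I → ℝ) :=
  fun ω i => x i ω

/-- An order-`r` tensor is diagonal if its entries vanish at every index tuple whose entries are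
not all equal. -/
def IsDiagonalTensor {d r : ℕ} (T : (Fin r → Fin d) → ℝ) : Prop :=
  ∀ i : Fin r → Fin d, (∃ a b, i a ≠ i b) → T i = 0

end

/-! Write `P_j` for the coordinate projection onto block `j`. Everything passes through additivity
of the cumulant generating function near `0`: `K (∑ j, P_j t) = ∑ j, K (P_j t)`. Since `K` is
analytic at `0`, additivity is equivalent to the vanishing of its mixed Taylor coefficients, which
are the mixed cumulants.

Independence gives additivity by factoring `M` and taking logarithms. Conversely, additivity factors
`M` near `0`. Along each real line `s ↦ s • v` both sides extend holomorphically to a strip around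
the imaginary axis, so the identity theorem carries the factorization to `s = I`, where it factors
the characteristic function.

The common statement is `iIndepFun_subvector_iff_cumulantTensor_eq_zero`, whose blocks need not
cover all coordinates. The three claims are its cases of two blocks, a partition, and singletons. -/

/-! ### Analyticity of the generating functions at 0 -/

theorem norm_expSeries_real_le (n : ℕ) : ‖NormedSpace.expSeries ℝ ℝ n‖ ≤ (n.factorial : ℝ)⁻¹ := by
  rw [NormedSpace.expSeries, norm_smul, ContinuousMultilinearMap.norm_mkPiAlgebraFin, mul_one,
    Real.norm_of_nonneg (by positivity)]

/-- The moment generating function of a random continuous linear form with an exponential moment is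
analytic at `0`. -/
theorem analyticAt_integral_exp_clm {Ω E : Type*} [MeasurableSpace Ω] {μ : Measure Ω}
    [NormedAddCommGroup E] [NormedSpace ℝ E] {L : Ω → E →L[ℝ] ℝ} (hL : AEStronglyMeasurable L μ)
    {ε : ℝ} (hε : 0 < ε) (hint : Integrable (fun ω => Real.exp (ε * ‖L ω‖)) μ) :
    AnalyticAt ℝ (fun t => ∫ ω, Real.exp (L ω t) ∂μ) 0 := by
  set F : ℕ → ℝ := fun n => (ε ^ n)⁻¹ with hF
  set q : (n : ℕ) → Ω → ContinuousMultilinearMap ℝ (fun _ : Fin n => E) ℝ :=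
    fun n ω => (NormedSpace.expSeries ℝ ℝ n).compContinuousLinearMap (fun _ => L ω) with hq
  -- The inequality `u ^ n / n! ≤ exp u` at `u = ε * ‖L ω‖` gives one integrable majorant for all
  -- orders, at the cost of the factor `ε⁻ⁿ`; hence radius at least `ε`.
  have hqnorm : ∀ n ω, ‖q n ω‖ ≤ F n * Real.exp (ε * ‖L ω‖) := by
    intro n ω
    calc ‖q n ω‖ ≤ ‖NormedSpace.expSeries ℝ ℝ n‖ * ∏ _i : Fin n, ‖L ω‖ :=
          ContinuousMultilinearMap.norm_compContinuousLinearMap_le _ _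
      _ ≤ (n.factorial : ℝ)⁻¹ * ‖L ω‖ ^ n := by
          rw [Finset.prod_const, Finset.card_univ, Fintype.card_fin]
          gcongr
          exact norm_expSeries_real_le n
      _ = F n * ((ε * ‖L ω‖) ^ n / n.factorial) := by
          simp only [hF, mul_pow]; field_simp
      _ ≤ _ := by
          gcongr
          exact Real.pow_div_factorial_le_exp _ (by positivity) n
  have hqmeas : ∀ n, AEStronglyMeasurable (q n) μ := by
    intro n
    have hc : Continuous (fun l : E →L[ℝ] ℝ =>
        (NormedSpace.expSeries ℝ ℝ n).compContinuousLinearMap (fun _ => l)) :=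
      (ContinuousMultilinearMap.compContinuousLinearMapLRight (E := fun _ : Fin n => E)
        (NormedSpace.expSeries ℝ ℝ n)).cont.comp (continuous_pi fun _ => continuous_id)
    exact hc.comp_aestronglyMeasurable hL
  have hqint : ∀ n, Integrable (q n) μ := fun n =>
    (hint.const_mul (F n)).mono' (hqmeas n) (ae_of_all _ (hqnorm n))
  set C : ℝ := ∫ ω, Real.exp (ε * ‖L ω‖) ∂μ
  have hqC : ∀ n, ∫ ω, ‖q n ω‖ ∂μ ≤ F n * C := by
    intro n
    rw [← integral_const_mul]
    exact integral_mono (hqint n).norm (hint.const_mul _) (hqnorm n)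
  let p : FormalMultilinearSeries ℝ E ℝ := fun n => ∫ ω, q n ω ∂μ
  have hp : ∀ n, ‖p n‖ ≤ F n * C := fun n => (norm_integral_le_integral_norm _).trans (hqC n)
  refine ⟨p, ENNReal.ofReal ε, ⟨?_, by simpa using hε, ?_⟩⟩
  · refine p.le_radius_of_bound C (r := ε.toNNReal) fun n => ?_
    rw [Real.coe_toNNReal _ hε.le]
    calc ‖p n‖ * ε ^ n ≤ F n * C * ε ^ n := by gcongr; exact hp n
      _ = C := by simp only [hF]; field_simp
  · intro y hy
    have hy' : ‖y‖ < ε := by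
      rw [Metric.eball_ofReal, mem_ball_zero_iff] at hy
      exact hy
    rw [zero_add]
    have happ : ∀ n, p n (fun _ => y) = ∫ ω, q n ω (fun _ => y) ∂μ := fun n =>
      ((ContinuousMultilinearMap.apply ℝ (fun _ : Fin n => E) ℝ
        (fun _ => y)).integral_comp_comm (hqint n)).symm
    have hint' : ∀ n, Integrable (fun ω => q n ω (fun _ => y)) μ := fun n =>
      (ContinuousMultilinearMap.apply ℝ (fun _ : Fin n => E) ℝ
        (fun _ => y)).integrable_comp (hqint n)
    have hsumm : Summable fun n => ∫ ω, ‖q n ω (fun _ => y)‖ ∂μ := by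
      refine Summable.of_nonneg_of_le (fun n => integral_nonneg fun ω => norm_nonneg _) (fun n => ?_)
        ((summable_geometric_of_lt_one (r := ‖y‖ / ε) (by positivity)
          ((div_lt_one hε).2 hy')).mul_right C)
      calc ∫ ω, ‖q n ω (fun _ => y)‖ ∂μ ≤ ∫ ω, ‖q n ω‖ * ‖y‖ ^ n ∂μ := by
            refine integral_mono (hint' n).norm ((hqint n).norm.mul_const _) fun ω => ?_
            simpa using (q n ω).le_opNorm (fun _ => y)
        _ = (∫ ω, ‖q n ω‖ ∂μ) * ‖y‖ ^ n := integral_mul_const _ _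
        _ ≤ F n * C * ‖y‖ ^ n := by gcongr; exact hqC n
        _ = (‖y‖ / ε) ^ n * C := by simp only [hF, div_pow]; field_simp
    have hsum := hasSum_integral_of_summable_integral_norm hint' hsumm
    have htsum : ∀ ω, ∑' n, q n ω (fun _ => y) = Real.exp (L ω y) := by
      intro ω
      have := NormedSpace.expSeries_hasSum_exp (𝕂 := ℝ) (L ω y)
      rw [Real.exp_eq_exp_ℝ]
      exact this.tsum_eq
    simpa only [happ, htsum] using hsum

/-- The linear form `t ↦ tᵀ x` attached to a vector `x`. -/
noncomputable def dotCLM {d : ℕ} (x : Fin d → ℝ) : (Fin d → ℝ) →L[ℝ] ℝ :=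
  ∑ i, x i • ContinuousLinearMap.proj i

theorem dotCLM_apply {d : ℕ} (x t : Fin d → ℝ) : dotCLM x t = ∑ i, t i * x i := by
  simp [dotCLM, mul_comm]

theorem norm_dotCLM_le {d : ℕ} (x : Fin d → ℝ) : ‖dotCLM x‖ ≤ d * ‖x‖ := by
  refine ContinuousLinearMap.opNorm_le_bound _ (by positivity) fun t => ?_
  rw [dotCLM_apply]
  calc ‖∑ i, t i * x i‖ ≤ ∑ _i : Fin d, ‖x‖ * ‖t‖ := by
        refine norm_sum_le_of_le _ fun i _ => ?_
        rw [norm_mul, mul_comm]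
        gcongr <;> exact norm_le_pi_norm _ _
    _ = d * ‖x‖ * ‖t‖ := by simp [mul_assoc]

theorem exp_mul_norm_pi_le {d : ℕ} (x : Fin d → ℝ) (a : ℝ) :
    Real.exp (a * ‖x‖) ≤ 1 + ∑ i, Real.exp (a * |x i|) := by
  rcases isEmpty_or_nonempty (Fin d) with h | h
  · simp [Subsingleton.elim x 0]
  · obtain ⟨i, hi⟩ := Finset.exists_mem_eq_sup Finset.univ Finset.univ_nonempty (fun i => ‖x i‖₊)
    have : ‖x‖ = |x i| := by
      rw [Pi.norm_def, hi.2]; simp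
    rw [this]
    have := Finset.single_le_sum (f := fun i => Real.exp (a * |x i|))
      (fun j _ => (Real.exp_pos _).le) (Finset.mem_univ i)
    linarith

section RandomVector

variable {Ω : Type*} [MeasurableSpace Ω] {μ : Measure Ω} [IsProbabilityMeasure μ] {d : ℕ}
  {x : Fin d → Ω → ℝ}

theorem vecMGF_zero : vecMGF x μ 0 = 1 := by simp [vecMGF]

theorem vecCGF_zero : vecCGF x μ 0 = 0 := by simp [vecCGF, vecMGF_zero]

theorem exists_integrable_exp_mul_norm (hx : ∀ i, Measurable (x i))
    (hM : ∀ᶠ t in 𝓝 (0 : Fin d → ℝ), Integrable (fun ω => Real.exp (∑ i, t i * x i ω)) μ) :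
    ∃ ε > 0, Integrable (fun ω => Real.exp (ε * ‖dotCLM (fun i => x i ω)‖)) μ := by
  obtain ⟨δ, hδ, hball⟩ := Metric.eventually_nhds_iff.1 hM
  have hsingle : ∀ i, ∀ s : ℝ, |s| < δ → Integrable (fun ω => Real.exp (s * x i ω)) μ := by
    intro i s hs
    have := hball (y := Pi.single i s) (by simpa [dist_zero_right, Pi.norm_single] using hs)
    simpa [Pi.single_apply] using this
  have habs : ∀ i, Integrable (fun ω => Real.exp (δ / 2 * |x i ω|)) μ := by
    intro i
    refine integrable_exp_mul_abs (hsingle i _ ?_) (hsingle i _ ?_)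
    · rw [abs_of_pos] <;> linarith
    · rw [abs_neg, abs_of_pos] <;> linarith
  -- The divisor absorbs the factor `d` of `norm_dotCLM_le`; `d + 1` keeps it nonzero when `d = 0`.
  refine ⟨δ / 2 / (d + 1), by positivity, ?_⟩
  have hbound : Integrable (fun ω => 1 + ∑ i, Real.exp (δ / 2 * |x i ω|)) μ :=
    (integrable_const 1).add (integrable_finsetSum _ fun i _ => habs i)
  refine hbound.mono' ?_ (ae_of_all _ fun ω => ?_)
  · have : StronglyMeasurable fun ω => dotCLM (fun i => x i ω) :=
      Finset.stronglyMeasurable_fun_sum _ fun i _ => (hx i).stronglyMeasurable.smul_const _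
    exact (Real.measurable_exp.comp
      (this.norm.measurable.const_mul _)).aestronglyMeasurable
  · rw [Real.norm_of_nonneg (Real.exp_pos _).le]
    refine le_trans (Real.exp_le_exp.2 ?_) (exp_mul_norm_pi_le (fun i => x i ω) (δ / 2))
    calc δ / 2 / (d + 1) * ‖dotCLM (fun i => x i ω)‖
        ≤ δ / 2 / (d + 1) * ((d + 1) * ‖fun i => x i ω‖) := by
          gcongr
          exact (norm_dotCLM_le _).trans (by gcongr; linarith)
      _ = _ := by field_simp

theorem analyticAt_vecMGF (hx : ∀ i, Measurable (x i))
    (hM : ∀ᶠ t in 𝓝 (0 : Fin d → ℝ), Integrable (fun ω => Real.exp (∑ i, t i * x i ω)) μ) :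
    AnalyticAt ℝ (vecMGF x μ) 0 := by
  obtain ⟨ε, hε, h⟩ := exists_integrable_exp_mul_norm hx hM
  have hm : StronglyMeasurable fun ω => dotCLM (fun i => x i ω) :=
    Finset.stronglyMeasurable_fun_sum _ fun i _ => (hx i).stronglyMeasurable.smul_const _
  have heq : vecMGF x μ = fun t => ∫ ω, Real.exp (dotCLM (fun i => x i ω) t) ∂μ := by
    funext t
    simp only [vecMGF, dotCLM_apply]
  rw [heq]
  exact analyticAt_integral_exp_clm hm.aestronglyMeasurable hε h

theorem analyticAt_vecCGF (hx : ∀ i, Measurable (x i))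
    (hM : ∀ᶠ t in 𝓝 (0 : Fin d → ℝ), Integrable (fun ω => Real.exp (∑ i, t i * x i ω)) μ) :
    AnalyticAt ℝ (vecCGF x μ) 0 := by
  have h0 : 0 < vecMGF x μ 0 := by rw [vecMGF_zero]; exact one_pos
  exact AnalyticAt.comp (analyticAt_log h0) (analyticAt_vecMGF hx hM)

end RandomVector

/-! ### Block additivity and mixed derivatives -/

/-- The coordinate projection of `ℝ^d` that keeps the coordinates in `S` and kills the others. -/
noncomputable def coordProj {d : ℕ} (S : Finset (Fin d)) : (Fin d → ℝ) →L[ℝ] (Fin d → ℝ) :=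
  ContinuousLinearMap.pi fun i => if i ∈ S then ContinuousLinearMap.proj i else 0

theorem coordProj_apply {d : ℕ} (S : Finset (Fin d)) (t : Fin d → ℝ) (i : Fin d) :
    coordProj S t i = if i ∈ S then t i else 0 := by
  unfold coordProj
  rw [ContinuousLinearMap.pi_apply]
  split_ifs <;> rfl

theorem coordProj_single_of_mem {d : ℕ} {S : Finset (Fin d)} {i : Fin d} (h : i ∈ S) (a : ℝ) :
    coordProj S (Pi.single i a) = Pi.single i a := by
  ext k
  rw [coordProj_apply]
  by_cases hk : k = i
  · subst hk; simp [h]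
  · simp [Pi.single_eq_of_ne hk]

theorem coordProj_single_of_notMem {d : ℕ} {S : Finset (Fin d)} {i : Fin d} (h : i ∉ S) (a : ℝ) :
    coordProj S (Pi.single i a) = 0 := by
  ext k
  rw [coordProj_apply]
  by_cases hk : k = i
  · subst hk; simp [h]
  · simp [Pi.single_eq_of_ne hk]

theorem ContinuousMultilinearMap.apply_diagonal_eq_sum {d n : ℕ}
    (T : ContinuousMultilinearMap ℝ (fun _ : Fin n => Fin d → ℝ) ℝ) (v : Fin d → ℝ) :
    T (fun _ => v) = ∑ i : Fin n → Fin d, (∏ k, v (i k)) * T (fun k => Pi.single (i k) (1 : ℝ)) := by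
  have hv : v = ∑ i, v i • (Pi.single i (1 : ℝ) : Fin d → ℝ) := by
    ext k; simp [Finset.sum_apply, Pi.single_apply]
  conv_lhs => rw [hv]
  rw [T.map_sum]
  refine Finset.sum_congr rfl fun i _ => ?_
  rw [T.map_smul_univ, smul_eq_mul]

theorem AnalyticAt.iteratedFDeriv_comp_clm {E F : Type*} [NormedAddCommGroup E] [NormedSpace ℝ E]
    [NormedAddCommGroup F] [NormedSpace ℝ F] {f : E → F} (hf : AnalyticAt ℝ f 0)
    [CompleteSpace F] (g : E →L[ℝ] E) (n : ℕ) :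
    iteratedFDeriv ℝ n (f ∘ g) 0 = (iteratedFDeriv ℝ n f 0).compContinuousLinearMap fun _ => g := by
  obtain ⟨r, hr, hball⟩ := hf.exists_ball_analyticOnNhd
  have hs : IsOpen (Metric.ball (0 : E) r) := Metric.isOpen_ball
  have hs' : IsOpen (g ⁻¹' Metric.ball (0 : E) r) := hs.preimage g.continuous
  have h0 : g 0 ∈ Metric.ball (0 : E) r := by simpa using hr
  have h := g.iteratedFDerivWithin_comp_right (n := n) (i := n)
    (hball.contDiffOn hs.uniqueDiffOn) hs.uniqueDiffOn hs'.uniqueDiffOn h0 le_rfl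
  rw [iteratedFDerivWithin_of_isOpen n hs' (show (0 : E) ∈ g ⁻¹' _ from h0),
    iteratedFDerivWithin_of_isOpen n hs h0, map_zero] at h
  exact h

section Blocks

variable {d : ℕ} {ι : Type*} [Fintype ι] {B : ι → Finset (Fin d)}

theorem sum_coordProj_apply_of_mem (hB : Pairwise (Function.onFun Disjoint B)) {t : Fin d → ℝ}
    {j : ι} {i : Fin d} (hi : i ∈ B j) : (∑ k, coordProj (B k) t) i = t i := by
  rw [Finset.sum_apply, Finset.sum_eq_single j]
  · rw [coordProj_apply, if_pos hi]
  · intro k _ hk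
    rw [coordProj_apply, if_neg (Finset.disjoint_right.1 (hB hk) hi)]
  · simp

theorem sum_coordProj_apply_of_notMem {t : Fin d → ℝ} {i : Fin d} (hi : ∀ j, i ∉ B j) :
    (∑ k, coordProj (B k) t) i = 0 := by
  rw [Finset.sum_apply]
  exact Finset.sum_eq_zero fun k _ => by rw [coordProj_apply, if_neg (hi k)]

/-- Expand both sides over tuples of basis vectors. A tuple inside one block has the same
coefficient on both sides, a mixed tuple is killed by `hT`, and a tuple leaving all blocks has
coefficient zero. Order `0` must be excluded: there the right side counts the constant once per
block. -/
theorem multilinear_sum_coordProj (hB : Pairwise (Function.onFun Disjoint B)) {n : ℕ} (hn : n ≠ 0)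
    (T : ContinuousMultilinearMap ℝ (fun _ : Fin n => Fin d → ℝ) ℝ)
    (hT : ∀ i : Fin n → Fin d, (∀ a, ∃ j, i a ∈ B j) →
      (∃ j k, j ≠ k ∧ (∃ a, i a ∈ B j) ∧ ∃ b, i b ∈ B k) →
      T (fun k => Pi.single (i k) (1 : ℝ)) = 0) (t : Fin d → ℝ) :
    T (fun _ => ∑ j, coordProj (B j) t) = ∑ j, T (fun _ => coordProj (B j) t) := by
  have hpos : 0 < n := Nat.pos_of_ne_zero hn
  simp_rw [T.apply_diagonal_eq_sum]
  rw [Finset.sum_comm]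
  refine Finset.sum_congr rfl fun i _ => ?_
  rw [← Finset.sum_mul]
  by_cases hmem : ∀ a, ∃ j, i a ∈ B j
  · by_cases hmix : ∃ j k, j ≠ k ∧ (∃ a, i a ∈ B j) ∧ ∃ b, i b ∈ B k
    · rw [hT i hmem hmix, mul_zero, mul_zero]
    · congr 1
      obtain ⟨j, hj⟩ := hmem ⟨0, hpos⟩
      have hall : ∀ a, i a ∈ B j := by
        intro a
        obtain ⟨k, hk⟩ := hmem a
        by_contra hne
        exact hmix ⟨j, k, fun h => hne (h ▸ hk), ⟨_, hj⟩, ⟨_, hk⟩⟩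
      rw [Finset.prod_congr rfl fun a _ => sum_coordProj_apply_of_mem (t := t) hB (hall a)]
      symm
      refine (Finset.sum_eq_single j ?_ ?_).trans ?_
      · intro k _ hk
        refine Finset.prod_eq_zero (Finset.mem_univ ⟨0, hpos⟩) ?_
        rw [coordProj_apply, if_neg (Finset.disjoint_right.1 (hB hk) hj)]
      · simp
      · exact Finset.prod_congr rfl fun a _ => by rw [coordProj_apply, if_pos (hall a)]
  · push Not at hmem
    obtain ⟨a, ha⟩ := hmem
    congr 1
    refine (Finset.prod_eq_zero (Finset.mem_univ a) ?_).trans (Finset.sum_eq_zero fun j _ => Finset.prod_eq_zero (Finset.mem_univ a) ?_).symm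
    · exact sum_coordProj_apply_of_notMem ha
    · rw [coordProj_apply, if_neg (ha j)]

/-- Compare Taylor series term by term; `hf0` settles order zero. -/
theorem eventually_additive_of_iteratedFDeriv_eq_zero (hB : Pairwise (Function.onFun Disjoint B))
    {f : (Fin d → ℝ) → ℝ} (hf : AnalyticAt ℝ f 0) (hf0 : f 0 = 0)
    (h : ∀ (n : ℕ) (i : Fin n → Fin d), (∀ a, ∃ j, i a ∈ B j) →
      (∃ j k, j ≠ k ∧ (∃ a, i a ∈ B j) ∧ ∃ b, i b ∈ B k) →
      iteratedFDeriv ℝ n f 0 (fun k => Pi.single (i k) (1 : ℝ)) = 0) :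
    ∀ᶠ t in 𝓝 (0 : Fin d → ℝ), f (∑ j, coordProj (B j) t) = ∑ j, f (coordProj (B j) t) := by
  obtain ⟨p, r, hp⟩ := hf
  have hball : Metric.eball (0 : Fin d → ℝ) r ∈ 𝓝 0 := Metric.eball_mem_nhds 0 hp.r_pos
  have hsum : ∀ᶠ t in 𝓝 (0 : Fin d → ℝ), ∑ j, coordProj (B j) t ∈ Metric.eball 0 r := by
    have hc : Continuous fun t : Fin d → ℝ => ∑ j, coordProj (B j) t := by fun_prop
    exact hc.continuousAt.eventually_mem (by simpa using hball)
  have heach : ∀ᶠ t in 𝓝 (0 : Fin d → ℝ), ∀ j, coordProj (B j) t ∈ Metric.eball 0 r := by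
    refine eventually_all.2 fun j => ?_
    exact (coordProj (B j)).continuous.continuousAt.eventually_mem (by simpa using hball)
  filter_upwards [hsum, heach] with t h1 h2
  have e1 := hp.hasSum_iteratedFDeriv h1
  have e2 := hasSum_sum fun j (_ : j ∈ Finset.univ) => hp.hasSum_iteratedFDeriv (h2 j)
  simp only [zero_add] at e1 e2
  refine e1.unique (e2.congr_fun fun n => ?_)
  rcases eq_or_ne n 0 with rfl | hn
  · simp [iteratedFDeriv_zero_apply, hf0]
  · rw [multilinear_sum_coordProj hB hn _ (h n), Finset.smul_sum]

/-- Differentiate the additivity identity. On the left the projection fixes every basis vector in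
play; on the right each block's projection kills at least one vector of a mixed tuple. -/
theorem iteratedFDeriv_eq_zero_of_eventually_additive (hB : Pairwise (Function.onFun Disjoint B))
    {f : (Fin d → ℝ) → ℝ} (hf : AnalyticAt ℝ f 0)
    (h : ∀ᶠ t in 𝓝 (0 : Fin d → ℝ), f (∑ j, coordProj (B j) t) = ∑ j, f (coordProj (B j) t))
    (n : ℕ) (i : Fin n → Fin d) (hi : ∀ a, ∃ j, i a ∈ B j)
    (hmix : ∃ j k, j ≠ k ∧ (∃ a, i a ∈ B j) ∧ ∃ b, i b ∈ B k) :
    iteratedFDeriv ℝ n f 0 (fun k => Pi.single (i k) (1 : ℝ)) = 0 := by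
  set P : (Fin d → ℝ) →L[ℝ] (Fin d → ℝ) := ∑ j, coordProj (B j) with hP
  have hPt : ∀ t, P t = ∑ j, coordProj (B j) t := fun t => by simp [hP]
  have heq : (f ∘ P) =ᶠ[𝓝 0] fun t => ∑ j, (f ∘ coordProj (B j)) t := by
    filter_upwards [h] with t ht
    simpa [hPt] using ht
  have hcd : ∀ j, ContDiffAt ℝ n (f ∘ coordProj (B j)) 0 := fun j =>
    ContDiffAt.comp 0 (by rw [map_zero]; exact hf.contDiffAt) (coordProj (B j)).contDiff.contDiffAt
  have hder := (heq.iteratedFDeriv ℝ n).eq_of_nhds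
  rw [iteratedFDeriv_fun_sum_apply fun j _ => hcd j, hf.iteratedFDeriv_comp_clm] at hder
  have := congrArg (fun T => T (fun k => Pi.single (i k) (1 : ℝ))) hder
  simp only [sum_apply, hf.iteratedFDeriv_comp_clm,
    ContinuousMultilinearMap.compContinuousLinearMap_apply] at this
  have hPi : ∀ k, P (Pi.single (i k) 1) = Pi.single (i k) 1 := by
    intro k
    obtain ⟨j, hj⟩ := hi k
    rw [hPt, Finset.sum_eq_single j, coordProj_single_of_mem hj]
    · intro l _ hl
      exact coordProj_single_of_notMem (Finset.disjoint_right.1 (hB hl) hj) _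
    · simp
  simp only [hPi] at this
  rw [this]
  refine Finset.sum_eq_zero fun j _ => ?_
  obtain ⟨a, ha⟩ : ∃ a, i a ∉ B j := by
    obtain ⟨j₁, j₂, hne, ⟨a, ha⟩, ⟨b, hb⟩⟩ := hmix
    by_contra! hall
    have e1 : j = j₁ := by
      by_contra hj
      exact Finset.disjoint_right.1 (hB hj) ha (hall a)
    have e2 : j = j₂ := by
      by_contra hj
      exact Finset.disjoint_right.1 (hB hj) hb (hall b)
    exact hne (e1.symm.trans e2)
  exact ContinuousMultilinearMap.map_coord_zero _ a (coordProj_single_of_notMem ha _)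

end Blocks

/-! ### From moment generating functions to independence -/

theorem aestronglyMeasurable_exp_dual_mul_I {F : Type*} [NormedAddCommGroup F] [NormedSpace ℝ F]
    [MeasurableSpace F] [BorelSpace F] (l : StrongDual ℝ F) (ν : Measure F) :
    AEStronglyMeasurable (fun y => Complex.exp (l y * Complex.I)) ν := by
  have : Measurable fun y => Complex.exp (l y * Complex.I) := by fun_prop
  exact this.aestronglyMeasurable

section MGF

variable {Ω : Type*} [MeasurableSpace Ω] {μ : Measure Ω}

/-- If the moment generating function of `Y` factors near `0` through those of the `X j`, then so
does its complex moment generating function on the imaginary axis. -/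
theorem complexMGF_I_eq_prod_of_eventually_mgf_eq_prod {ι : Type*} [Fintype ι] {Y : Ω → ℝ}
    {X : ι → Ω → ℝ}
    (hY : 0 ∈ interior (integrableExpSet Y μ)) (hX : ∀ j, 0 ∈ interior (integrableExpSet (X j) μ))
    (h : ∀ᶠ s in 𝓝 (0 : ℝ), mgf Y μ s = ∏ j, mgf (X j) μ s) :
    complexMGF Y μ Complex.I = ∏ j, complexMGF (X j) μ Complex.I := by
  obtain ⟨δ, hδ, hball⟩ : ∃ δ > 0, ∀ s : ℝ, s ∈ Metric.ball (0 : ℝ) δ →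
      s ∈ interior (integrableExpSet Y μ) ∧ ∀ j, s ∈ interior (integrableExpSet (X j) μ) := by
    have h1 : ∀ᶠ s in 𝓝 (0 : ℝ), s ∈ interior (integrableExpSet Y μ) ∧
        ∀ j, s ∈ interior (integrableExpSet (X j) μ) :=
      Eventually.and (isOpen_interior.mem_nhds hY)
        (eventually_all.2 fun j => isOpen_interior.mem_nhds (hX j))
    exact Metric.eventually_nhds_iff_ball.1 h1
  -- A vertical strip: the complex generating functions are analytic on it, and it contains both `0`
  -- and `I`.
  set U : Set ℂ := {z | z.re ∈ Metric.ball (0 : ℝ) δ}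
  have hYa : AnalyticOnNhd ℂ (complexMGF Y μ) U := fun z hz =>
    analyticAt_complexMGF (hball _ hz).1
  have hXa : AnalyticOnNhd ℂ (fun z => ∏ j, complexMGF (X j) μ z) U := fun z hz =>
    Finset.analyticAt_fun_prod _ fun j _ => analyticAt_complexMGF ((hball _ hz).2 j)
  have hU : IsPreconnected U :=
    ((convex_ball (0 : ℝ) δ).linear_preimage Complex.reLm).isPreconnected
  have hfreq : ∃ᶠ z in 𝓝[≠] (0 : ℂ), complexMGF Y μ z = ∏ j, complexMGF (X j) μ z := by
    have ht : Tendsto (fun s : ℝ => (s : ℂ)) (𝓝[≠] 0) (𝓝[≠] 0) := by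
      refine tendsto_nhdsWithin_iff.2 ⟨?_, ?_⟩
      · exact (Complex.continuous_ofReal.tendsto' 0 0 Complex.ofReal_zero).mono_left
          nhdsWithin_le_nhds
      · filter_upwards [self_mem_nhdsWithin] with s hs
        simpa using hs
    refine ht.frequently (Eventually.frequently ?_)
    filter_upwards [h.filter_mono nhdsWithin_le_nhds] with s hs
    simp only [complexMGF_ofReal, hs, Complex.ofReal_prod]
  exact hYa.eqOn_of_preconnected_of_frequently_eq hXa hU (z₀ := 0) (by simpa [U] using hδ) hfreq
    (by simpa [U] using hδ)

variable {d : ℕ} {x : Fin d → Ω → ℝ}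

theorem mgf_dot_eq_vecMGF (v : Fin d → ℝ) (s : ℝ) :
    mgf (fun ω => ∑ i, v i * x i ω) μ s = vecMGF x μ (s • v) := by
  simp only [mgf, vecMGF, Finset.mul_sum, Pi.smul_apply, smul_eq_mul, mul_assoc]

theorem tendsto_smul_zero_nhds (v : Fin d → ℝ) :
    Tendsto (fun s : ℝ => s • v) (𝓝 0) (𝓝 0) :=
  (continuous_id.smul continuous_const).tendsto' 0 0 (zero_smul ℝ v)

theorem zero_mem_interior_integrableExpSet_dot
    (hM : ∀ᶠ t in 𝓝 (0 : Fin d → ℝ), Integrable (fun ω => Real.exp (∑ i, t i * x i ω)) μ)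
    (v : Fin d → ℝ) : 0 ∈ interior (integrableExpSet (fun ω => ∑ i, v i * x i ω) μ) := by
  rw [mem_interior_iff_mem_nhds]
  filter_upwards [(tendsto_smul_zero_nhds v).eventually hM] with s hs
  simpa only [integrableExpSet, Set.mem_ofPred_eq, Finset.mul_sum, Pi.smul_apply, smul_eq_mul,
    mul_assoc] using hs

variable {ι : Type*} [Fintype ι] {B : ι → Finset (Fin d)}

theorem measurable_subvector (hx : ∀ i, Measurable (x i)) (I : Finset (Fin d)) :
    Measurable (subvector x I) :=
  measurable_pi_lambda _ fun i => hx i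

theorem vecMGF_sum_coordProj_of_iIndepFun (hx : ∀ i, Measurable (x i))
    (h : iIndepFun (fun j => subvector x (B j)) μ) (t : Fin d → ℝ) :
    vecMGF x μ (∑ j, coordProj (B j) t) = ∏ j, vecMGF x μ (coordProj (B j) t) := by
  have hcomp : ∀ j ω, ∑ i : B j, t i * subvector x (B j) ω i =
      ∑ i, coordProj (B j) t i * x i ω := by
    intro j ω
    simp only [subvector, coordProj_apply, ite_mul, zero_mul, Finset.sum_ite_mem, Finset.univ_inter]
    exact Finset.sum_coe_sort (B j) (fun i => t i * x i ω)
  have hind : iIndepFun (fun j ω => ∑ i, coordProj (B j) t i * x i ω) μ := by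
    have := h.comp (fun j y => ∑ i : B j, t i * y i) fun j => by fun_prop
    simpa only [Function.comp_def, hcomp] using this
  have hsum := hind.mgf_sum (t := 1) (fun j => by fun_prop) Finset.univ
  simp only [mgf_dot_eq_vecMGF, one_smul] at hsum
  rw [← hsum, vecMGF, mgf]
  refine integral_congr_ae (ae_of_all _ fun ω => ?_)
  simp only [Finset.sum_apply, Finset.sum_mul, one_mul]
  rw [Finset.sum_comm]

variable [IsProbabilityMeasure μ]

theorem eventually_vecMGF_pos (hx : ∀ i, Measurable (x i))
    (hM : ∀ᶠ t in 𝓝 (0 : Fin d → ℝ), Integrable (fun ω => Real.exp (∑ i, t i * x i ω)) μ) :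
    ∀ᶠ t in 𝓝 (0 : Fin d → ℝ), 0 < vecMGF x μ t :=
  (analyticAt_vecMGF hx hM).continuousAt.eventually_const_lt (by rw [vecMGF_zero]; exact one_pos)

theorem eventually_vecCGF_additive_of_iIndepFun (hx : ∀ i, Measurable (x i))
    (hM : ∀ᶠ t in 𝓝 (0 : Fin d → ℝ), Integrable (fun ω => Real.exp (∑ i, t i * x i ω)) μ)
    (h : iIndepFun (fun j => subvector x (B j)) μ) :
    ∀ᶠ t in 𝓝 (0 : Fin d → ℝ),
      vecCGF x μ (∑ j, coordProj (B j) t) = ∑ j, vecCGF x μ (coordProj (B j) t) := by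
  have hpos : ∀ᶠ t in 𝓝 (0 : Fin d → ℝ), ∀ j, 0 < vecMGF x μ (coordProj (B j) t) :=
    eventually_all.2 fun j => ((coordProj (B j)).continuous.tendsto' 0 0 (map_zero _)).eventually
      (eventually_vecMGF_pos hx hM)
  filter_upwards [hpos] with t ht
  simp only [vecCGF]
  rw [vecMGF_sum_coordProj_of_iIndepFun hx h, Real.log_prod fun j _ => (ht j).ne']

theorem eventually_vecMGF_multiplicative (hx : ∀ i, Measurable (x i))
    (hM : ∀ᶠ t in 𝓝 (0 : Fin d → ℝ), Integrable (fun ω => Real.exp (∑ i, t i * x i ω)) μ)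
    (h : ∀ᶠ t in 𝓝 (0 : Fin d → ℝ),
      vecCGF x μ (∑ j, coordProj (B j) t) = ∑ j, vecCGF x μ (coordProj (B j) t)) :
    ∀ᶠ t in 𝓝 (0 : Fin d → ℝ),
      vecMGF x μ (∑ j, coordProj (B j) t) = ∏ j, vecMGF x μ (coordProj (B j) t) := by
  have hpos : ∀ᶠ t in 𝓝 (0 : Fin d → ℝ), ∀ j, 0 < vecMGF x μ (coordProj (B j) t) :=
    eventually_all.2 fun j => ((coordProj (B j)).continuous.tendsto' 0 0 (map_zero _)).eventually
      (eventually_vecMGF_pos hx hM)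
  have hpos' : ∀ᶠ t in 𝓝 (0 : Fin d → ℝ), 0 < vecMGF x μ (∑ j, coordProj (B j) t) := by
    have hc : Continuous fun t : Fin d → ℝ => ∑ j, coordProj (B j) t := by fun_prop
    exact (hc.tendsto' 0 0 (by simp)).eventually (eventually_vecMGF_pos hx hM)
  filter_upwards [h, hpos, hpos'] with t ht h1 h2
  rw [← Real.exp_log h2, show Real.log _ = _ from ht, Real.exp_sum]
  exact Finset.prod_congr rfl fun j _ => Real.exp_log (h1 j)

/-- Independence is tested on one functional `L` at a time, so only the line through its coefficient
vector matters and one-variable complex analysis suffices. -/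
theorem iIndepFun_subvector_of_eventually_vecMGF_multiplicative (hx : ∀ i, Measurable (x i))
    (hM : ∀ᶠ t in 𝓝 (0 : Fin d → ℝ), Integrable (fun ω => Real.exp (∑ i, t i * x i ω)) μ)
    (hB : Pairwise (Function.onFun Disjoint B))
    (h : ∀ᶠ t in 𝓝 (0 : Fin d → ℝ),
      vecMGF x μ (∑ j, coordProj (B j) t) = ∏ j, vecMGF x μ (coordProj (B j) t)) :
    iIndepFun (fun j => subvector x (B j)) μ := by
  classical
  have hm := fun j => measurable_subvector hx (B j)
  have hmpi : Measurable fun ω j => subvector x (B j) ω := measurable_pi_lambda _ hm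
  rw [iIndepFun_iff_charFunDual_pi fun j => (hm j).aemeasurable]
  intro L
  -- The coefficients of `L` on block `j`, extended by zero; disjointness lets `v = ∑ j, w j`
  -- recover each `w j` by projection.
  set w : (j : ι) → Fin d → ℝ := fun j i =>
    if hi : i ∈ B j then L (Pi.single j (Pi.single ⟨i, hi⟩ 1)) else 0 with hw
  set v : Fin d → ℝ := ∑ j, w j with hv
  have hwv : ∀ j, coordProj (B j) v = w j := by
    intro j
    ext i
    rw [coordProj_apply]
    by_cases hi : i ∈ B j
    · rw [if_pos hi, hv, Finset.sum_apply, Finset.sum_eq_single j]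
      · intro k _ hk
        simp only [hw]
        rw [dif_neg (Finset.disjoint_right.1 (hB hk) hi)]
      · simp
    · simp only [hw]
      rw [if_neg hi, dif_neg hi]
  have hcomp : ∀ j ω, L (Pi.single j (subvector x (B j) ω)) = ∑ i, w j i * x i ω := by
    intro j ω
    have hs : subvector x (B j) ω = ∑ i : B j, x i ω • (Pi.single i (1 : ℝ) : B j → ℝ) := by
      ext k; simp [subvector, Finset.sum_apply, Pi.single_apply]
    have hL : L (Pi.single j (subvector x (B j) ω)) =
        (L.comp (.single ℝ (fun j => B j → ℝ) j)) (subvector x (B j) ω) := rfl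
    rw [hL, hs, map_sum]
    simp only [map_smul, smul_eq_mul]
    rw [← Finset.sum_subset (Finset.subset_univ (B j)), ← Finset.sum_coe_sort (B j)]
    · refine Finset.sum_congr rfl fun i _ => ?_
      rw [mul_comm]
      simp only [hw]
      rw [dif_pos i.2]
      rfl
    · intro i _ hi
      simp only [hw]
      rw [dif_neg hi, zero_mul]
  have hfull : ∀ ω, L (fun j => subvector x (B j) ω) = ∑ i, v i * x i ω := by
    intro ω
    rw [← Finset.univ_sum_single (fun j => subvector x (B j) ω), map_sum]
    simp only [hcomp, hv, Finset.sum_apply, Finset.sum_mul]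
    rw [Finset.sum_comm]
  have hmgf : ∀ᶠ s in 𝓝 (0 : ℝ), mgf (fun ω => ∑ i, v i * x i ω) μ s =
      ∏ j, mgf (fun ω => ∑ i, w j i * x i ω) μ s := by
    filter_upwards [(tendsto_smul_zero_nhds v).eventually h] with s hs
    simp only [mgf_dot_eq_vecMGF]
    simpa only [map_smul, hwv, ← Finset.smul_sum, ← hv] using hs
  have key := complexMGF_I_eq_prod_of_eventually_mgf_eq_prod
    (zero_mem_interior_integrableExpSet_dot hM v)
    (fun j => zero_mem_interior_integrableExpSet_dot hM (w j)) hmgf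
  have hc : ∀ u : Fin d → ℝ, complexMGF (fun ω => ∑ i, u i * x i ω) μ Complex.I =
      ∫ ω, Complex.exp (((∑ i, u i * x i ω : ℝ) : ℂ) * Complex.I) ∂μ := fun u => by
    simp only [complexMGF, mul_comm]
  rw [charFunDual_apply, integral_map hmpi.aemeasurable (aestronglyMeasurable_exp_dual_mul_I L _)]
  simp only [hfull]
  rw [← hc, key]
  refine Finset.prod_congr rfl fun j _ => ?_
  rw [charFunDual_apply, integral_map (hm j).aemeasurable 
    (aestronglyMeasurable_exp_dual_mul_I _ _), hc]
  refine integral_congr_ae (ae_of_all _ fun ω => ?_)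
  simp only [← hcomp]
  rfl

/-- Subvectors of `x` along pairwise disjoint blocks of coordinates are mutually independent if and
only if all cumulants mixing at least two blocks vanish. -/
theorem iIndepFun_subvector_iff_cumulantTensor_eq_zero (hx : ∀ i, Measurable (x i))
    (hM : ∀ᶠ t in 𝓝 (0 : Fin d → ℝ), Integrable (fun ω => Real.exp (∑ i, t i * x i ω)) μ)
    (hB : Pairwise (Function.onFun Disjoint B)) :
    iIndepFun (fun j => subvector x (B j)) μ ↔
      ∀ (r : ℕ) (i : Fin r → Fin d), (∀ a, ∃ j, i a ∈ B j) →
        (∃ j k, j ≠ k ∧ (∃ a, i a ∈ B j) ∧ ∃ b, i b ∈ B k) → cumulantTensor x μ r i = 0 :=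
  ⟨fun h => iteratedFDeriv_eq_zero_of_eventually_additive hB (analyticAt_vecCGF hx hM)
      (eventually_vecCGF_additive_of_iIndepFun hx hM h),
    fun h => iIndepFun_subvector_of_eventually_vecMGF_multiplicative hx hM hB
      (eventually_vecMGF_multiplicative hx hM (eventually_additive_of_iteratedFDeriv_eq_zero hB
        (analyticAt_vecCGF hx hM) vecCGF_zero h))⟩

end MGF

/-! ### Two blocks, partitions and singletons -/

theorem indepFun_iff_iIndepFun_bool {Ω : Type*} [MeasurableSpace Ω] {μ : Measure Ω}
    [IsProbabilityMeasure μ] {β : Bool → Type*} [∀ b, MeasurableSpace (β b)] (f : ∀ b, Ω → β b) :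
    IndepFun (f true) (f false) μ ↔ iIndepFun f μ := by
  refine ⟨fun h => ?_, fun h => h.indepFun (by decide)⟩
  rw [iIndepFun_iff_measure_inter_preimage_eq_mul]
  intro S sets hS
  have hmul := h.measure_inter_preimage_eq_mul
  by_cases ht : true ∈ S <;> by_cases hf : false ∈ S
  · obtain rfl : S = {true, false} := by ext b; cases b <;> simp [ht, hf]
    rw [Finset.set_biInter_insert, Finset.set_biInter_singleton, Finset.prod_pair (by decide)]
    exact hmul _ _ (hS true ht) (hS false hf)
  · obtain rfl : S = {true} := by ext b; cases b <;> simp [ht, hf]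
    simp
  · obtain rfl : S = {false} := by ext b; cases b <;> simp [ht, hf]
    simp
  · obtain rfl : S = ∅ := by ext b; cases b <;> simp [ht, hf]
    simp

theorem iIndepFun_iff_iIndepFun_subvector_singleton {Ω : Type*} [MeasurableSpace Ω] {μ : Measure Ω}
    {d : ℕ} (x : Fin d → Ω → ℝ) :
    iIndepFun x μ ↔ iIndepFun (fun i => subvector x {i}) μ := by
  constructor
  · intro h
    have hcomp := h.comp (fun i y => fun _ : ({i} : Finset (Fin d)) => y) fun i => by fun_prop
    convert hcomp using 1
    funext i ω k
    obtain ⟨k, hk⟩ := k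
    obtain rfl := Finset.mem_singleton.1 hk
    rfl
  · intro h
    exact h.comp (fun i y => y ⟨i, Finset.mem_singleton_self i⟩) fun i => by fun_prop

theorem mainTheorem8 {Ω : Type*} [MeasurableSpace Ω] (μ : Measure Ω) [IsProbabilityMeasure μ]
    {d : ℕ} (x : Fin d → Ω → ℝ) (hx : ∀ i, Measurable (x i))
    (hM : ∀ᶠ t in 𝓝 (0 : Fin d → ℝ), Integrable (fun ω => Real.exp (∑ i, t i * x i ω)) μ) :
    (∀ I J : Finset (Fin d), Disjoint I J →
      (IndepFun (subvector x I) (subvector x J) μ ↔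
        ∀ (r : ℕ) (i : Fin r → Fin d), (∀ a, i a ∈ I ∪ J) → (∃ a, i a ∈ I) → (∃ b, i b ∈ J) →
          cumulantTensor x μ r i = 0)) ∧
    (∀ (m : ℕ) (B : Fin m → Finset (Fin d)), (∀ j k, j ≠ k → Disjoint (B j) (B k)) →
      (∀ i, ∃ j, i ∈ B j) →
      (iIndepFun (fun j => subvector x (B j)) μ ↔
        ∀ (r : ℕ) (i : Fin r → Fin d),
          (∃ j k, j ≠ k ∧ (∃ a, i a ∈ B j) ∧ (∃ b, i b ∈ B k)) →
          cumulantTensor x μ r i = 0)) ∧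
    (iIndepFun x μ ↔ ∀ r : ℕ, 2 ≤ r → IsDiagonalTensor (cumulantTensor x μ r)) := by
  refine ⟨fun I J hIJ => ?_, fun m B hB hcov => ?_, ?_⟩
  · have hB : Pairwise (Function.onFun Disjoint fun b : Bool => cond b I J) := by
      rintro (_ | _) (_ | _) h
      exacts [absurd rfl h, hIJ.symm, hIJ, absurd rfl h]
    refine (indepFun_iff_iIndepFun_bool fun b : Bool => subvector x (cond b I J)).trans
      ((iIndepFun_subvector_iff_cumulantTensor_eq_zero hx hM hB).trans ?_)
    refine forall₂_congr fun r i => ?_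
    simp only [Bool.exists_bool, cond_true, cond_false, Finset.mem_union]
    constructor
    · intro h h1 h2 h3
      exact h (fun a => (h1 a).symm) (Or.inl (Or.inr ⟨by decide, h3, h2⟩))
    · intro h h1 h2
      refine h (fun a => (h1 a).symm) ?_ ?_ <;>
      · rcases h2 with (⟨hne, _⟩ | ⟨_, ha, hb⟩) | (⟨_, ha, hb⟩ | ⟨hne, _⟩)
        all_goals first | exact absurd rfl hne | assumption
  · rw [iIndepFun_subvector_iff_cumulantTensor_eq_zero hx hM fun j k hjk => hB j k hjk]
    exact forall₂_congr fun r i => ⟨fun h => h fun a => hcov (i a), fun h _ => h⟩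
  · rw [iIndepFun_iff_iIndepFun_subvector_singleton,
      iIndepFun_subvector_iff_cumulantTensor_eq_zero hx hM fun i j hij =>
        Finset.disjoint_singleton.2 hij]
    constructor
    · rintro h r - i ⟨a, b, hab⟩
      exact h r i (fun c => ⟨i c, Finset.mem_singleton_self _⟩)
        ⟨i a, i b, hab, ⟨a, Finset.mem_singleton_self _⟩, ⟨b, Finset.mem_singleton_self _⟩⟩
    · rintro h r i - ⟨j, k, hjk, ⟨a, ha⟩, ⟨b, hb⟩⟩
      rw [Finset.mem_singleton] at ha hb
      have hab : i a ≠ i b := by rwa [ha, hb]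
      -- Two distinct entries force two distinct positions, so orders below two impose no condition.
      have hr : 2 ≤ r := by
        by_contra hr
        exact hab (congrArg i (Fin.ext (by omega)))
      exact h r hr i ⟨a, b, hab⟩
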